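/- Let $\mathcal X$ be a metric space with its Borel $\sigma$-algebra, let $\mathcal Y\subset\mathbb R$ be closed, and let $\mathcal X_1,\dots,\mathcal X_B\subset\mathcal X$ be subsets (regions, not necessarily disjoint) each of which is a complete separable metric space. Let $w_1,\dots,w_B:\mathcal X\to[0,1]$ be measurable with $\sum_{b=1}^B w_b(x)=1$ for all $x\in\mathcal X$ and $w_b(x)=0$ for all $x\notin\mathcal X_b$. For each $b$ let $H_b$ be the RKHS on $\mathcal X_b$ of a bounded and continuous real kernel $k_b$ (bounded: $\sup_{x\in\mathcal X_b}\sqrt{k_b(x,x)}<\infty$), and let $\lambda_b>0$. Let $L:\mathcal Y\times\mathbb R\to[0,\infty)$ be measurable, convex in its last argument, and Lipschitz continuous in its last argument with a constant not depending on $y$. Assume that the derivatives $L'(y,\cdot)$ and $L''(y,\cdot)$ with respect to the last argument exist and are continuous for every $y\in\mathcal Y$, with $0<\sup_{y\in\mathcal Y,\,t\in\mathbb R}|L'(y,t)|<\infty$ and $\sup_{y\in\mathcal Y,\,t\in\mathbb R}|L''(y,t)|<\infty$. Put $L^\star(y,t)=L(y,t)-L(y,0)$. For a probability measure $Q$ on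 $\mathcal X_b\times\mathcal Y$, let $S_b(Q)=f_{b,Q}$ be the local SVM, the minimizer over $f\in H_b$ of $\int L^\star(y,f(x))\,dQ(x,y)+\lambda_b\|f\|_{H_b}^2$. For a probability measure $P$ on $\mathcal X\times\mathcal Y$ let $P_b$ be the restriction of $P$ to $\mathcal X_b\times\mathcal Y$ divided by $P(\mathcal X_b\times\mathcal Y)$ (the null measure if $P(\mathcal X_b\times\mathcal Y)=0$). For a family $Q=(Q_b)_b$ of measures on the sets $\mathcal X_b\times\mathcal Y$ put $F_Q(x)=\sum_{b=1}^B w_b(x)f_{b,Q_b}(x)$, where $f_{b,Q_b}$ is an arbitrary measurable function if $Q_b$ is not a probability measure, and a summand is $0$ for $x\notin\mathcal X_b$. Put $f^{\mathrm{comp}}_P=F_{(P_b)_b}$. For $z\in\mathcal X\times\mathcal Y$ and $\varepsilon\in[0,1]$ put $\tilde P_{b,\varepsilon,z}=(1-\varepsilon)P_b+\varepsilon\delta_z$ if $z\in\mathcal X_b\times\mathcal Y$, and $\tilde P_{b,\varepsilon,z}=P_b$ otherwise. If $P(\mathcal X_b\times\mathcal Y)>0$ and $z\in\mathcal X_b\times\mathcal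 Y$, the local influence function is the limit in $H_b$ $$\mathrm{IF}_b(\delta_z;S_b,P_b)=\lim_{\varepsilon\downarrow0}\frac{S_b((1-\varepsilon)P_b+\varepsilon\delta_z)-S_b(P_b)}{\varepsilon};$$ in all other cases $\mathrm{IF}_b(\delta_z;S_b,P_b):=0$. Then for every probability measure $P$ on $\mathcal X\times\mathcal Y$ the following hold, where $P^{\mathcal X}$ is the marginal of $P$ on $\mathcal X$. (0) For every $b$ and every probability measure $Q$ on $\mathcal X_b\times\mathcal Y$ the local SVM $f_{b,Q}$ exists and is unique. There is a constant $C$, not depending on $z$, such that for every $z\in\mathcal X\times\mathcal Y$: (1) all local influence functions $\mathrm{IF}_b(\delta_z;S_b,P_b)$ exist; (2) (contamination within the regions) the functions $F_{(\tilde P_{b,\varepsilon,z})_b}$, $0\le\varepsilon<1$, belong to $L^\infty(P^{\mathcal X})$; the influence function of the composed predictor $$\mathrm{IF}^{\mathrm{comp}}(\delta_z;S,P)=\lim_{\varepsilon\downarrow0}\frac{F_{(\tilde P_{b,\varepsilon,z})_b}-f^{\mathrm{comp}}_P}{\varepsilon}$$ exists as a limit in $L^\infty(P^{\mathcal X})$,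 is bounded by $C$ in the norm of $L^\infty(P^{\mathcal X})$, and equals $\sum_{b=1}^B w_b\,\mathrm{IF}_b(\delta_z;S_b,P_b)$ $P^{\mathcal X}$-almost everywhere; (3) (contamination of $P$, followed by regional restriction and normalization) the functions $f^{\mathrm{comp}}_{(1-\varepsilon)P+\varepsilon\delta_z}$, $0\le\varepsilon<1$, belong to $L^\infty(P^{\mathcal X})$; the limit $$\lim_{\varepsilon\downarrow0}\frac{f^{\mathrm{comp}}_{(1-\varepsilon)P+\varepsilon\delta_z}-f^{\mathrm{comp}}_P}{\varepsilon}$$ exists in $L^\infty(P^{\mathcal X})$, is bounded by $C$ in norm, and equals $\sum_{b:\,P(\mathcal X_b\times\mathcal Y)>0}P(\mathcal X_b\times\mathcal Y)^{-1}\,w_b\,\mathrm{IF}_b(\delta_z;S_b,P_b)$ $P^{\mathcal X}$-almost everywhere. -/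

import Mathlib

open MeasureTheory Filter Topology Set
open scoped ENNReal

noncomputable section

namespace LocalSVM

/-- The real-valued reproducing kernel `k(x, x')` of a reproducing kernel Hilbert space of
real functions. Mathlib's `RKHS.kernel` is operator valued; an operator on `ℝ` is
identified with its value at `1`. -/
def scalarKernel {X : Type*} (H : Type*) [NormedAddCommGroup H] [InnerProductSpace ℝ H]
    [CompleteSpace H] [RKHS ℝ H X ℝ] (x x' : X) : ℝ :=
  RKHS.kernel H x x' 1

/-- The shifted loss `L⋆(y, t) = L(y, t) - L(y, 0)`. -/
def shiftedLoss {Y : Type*} (L : Y → ℝ → ℝ) (y : Y) (t : ℝ) : ℝ := L y t - L y 0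

section SVM

variable {X Y : Type*} [MeasurableSpace X] [MeasurableSpace Y]
  {H : Type*} [NormedAddCommGroup H] [InnerProductSpace ℝ H] [RKHS ℝ H X ℝ]

/-- The regularized theoretical risk `∫ L⋆(y, f(x)) dQ(x, y) + lam ‖f‖²` of `f ∈ H`. -/
def regRisk (L : Y → ℝ → ℝ) (Q : Measure (X × Y)) (lam : ℝ) (f : H) : ℝ :=
  ∫ p, shiftedLoss L p.2 (f p.1) ∂Q + lam * ‖f‖ ^ 2

/-- `f` is a (theoretical) support vector machine for `L⋆`, `Q`, `lam`: it minimizes the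
regularized risk over `H`. -/
def IsSVM (L : Y → ℝ → ℝ) (Q : Measure (X × Y)) (lam : ℝ) (f : H) : Prop :=
  ∀ h : H, regRisk L Q lam f ≤ regRisk L Q lam h

/-- The support vector machine, as a statistical operator `Q ↦ svm H L lam Q ∈ H`
(a minimizer of the regularized risk; arbitrary when there is none). -/
def svm (H : Type*) [NormedAddCommGroup H] [InnerProductSpace ℝ H] [RKHS ℝ H X ℝ]
    (L : Y → ℝ → ℝ) (lam : ℝ) (Q : Measure (X × Y)) : H :=
  Classical.epsilon fun f : H => IsSVM L Q lam f

end SVM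

section Influence

/-- The mixture `(1 - ε) P + ε δ_z`, for `0 ≤ ε ≤ 1`. -/
def contaminate {M : Type*} [MeasurableSpace M] (P : Measure M) (z : M) (ε : ℝ) : Measure M :=
  ENNReal.ofReal (1 - ε) • P + ENNReal.ofReal ε • Measure.dirac z

/-- `g` is the influence function of the statistical operator `S` at the point `z` for `P`:
the limit in `E`, as `ε ↓ 0`, of `(S((1 - ε) P + ε δ_z) - S(P)) / ε`. -/
def HasInfluenceFunction {M E : Type*} [MeasurableSpace M] [NormedAddCommGroup E]
    [NormedSpace ℝ E] (S : Measure M → E) (P : Measure M) (z : M) (g : E) : Prop :=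
  Tendsto (fun ε : ℝ => ε⁻¹ • (S (contaminate P z ε) - S P)) (𝓝[>] 0) (𝓝 g)

open Classical in
/-- The class in `L^∞(μ)` of a function; only meaningful for `f` with `MemLp f ∞ μ`. -/
def linftyClass {X : Type*} [MeasurableSpace X] (μ : Measure X) (f : X → ℝ) : Lp ℝ ∞ μ :=
  if h : MemLp f ∞ μ then h.toLp f else 0

end Influence

section Regions

variable {X Y : Type*} [MeasurableSpace X] [MeasurableSpace Y]

/-- The regional distribution on `A × Y`: the restriction of `P` to `A × Y`, divided by
`P(A × Y)`. It is the null measure when `P(A × Y) = 0`, since then it is `∞ • 0`. -/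
def regional (A : Set X) (P : Measure (X × Y)) : Measure (A × Y) :=
  (P (A ×ˢ univ))⁻¹ • P.comap (fun p : A × Y => ((p.1 : X), p.2))

open Classical in
/-- The regionwise mixture: `(1 - ε) P_A + ε δ_z` if `z ∈ A × Y`, and `P_A` otherwise, where
`P_A` is the regional distribution of `P` on `A × Y`. -/
def regionalContaminate (A : Set X) (P : Measure (X × Y)) (z : X × Y) (ε : ℝ) :
    Measure (A × Y) :=
  if h : z.1 ∈ A then contaminate (regional A P) (⟨z.1, h⟩, z.2) ε else regional A P

open Classical in
/-- Extension of a function on a region by zero. -/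
def extendZero {A : Set X} (f : A → ℝ) (x : X) : ℝ := if h : x ∈ A then f ⟨x, h⟩ else 0

open Classical in
/-- The predictor composed of local support vector machines,
`x ↦ ∑ b, w b x * f_b x`, where `f_b` is the support vector machine in `H b` for `Q b` if `Q b`
is a probability measure on `R b × Y`, and the prescribed function `v b` otherwise. -/
def compose {B : ℕ} {R : Fin B → Set X} (H : Fin B → Type*)
    [∀ b, NormedAddCommGroup (H b)] [∀ b, InnerProductSpace ℝ (H b)]
    [∀ b, RKHS ℝ (H b) (R b) ℝ] (L : Y → ℝ → ℝ) (lam : Fin B → ℝ) (w : Fin B → X → ℝ)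
    (v : ∀ b, R b → ℝ) (Q : ∀ b, Measure (R b × Y)) (x : X) : ℝ :=
  ∑ b, w b x *
    extendZero (if IsProbabilityMeasure (Q b) then ⇑(svm (H b) L (lam b) (Q b)) else v b) x

/-- The composed predictor `f^comp` of a distribution `P` on `X × Y`; `u P b` is the arbitrary
function used on regions with `P(R b × Y) = 0`. -/
def compPredictor {B : ℕ} {R : Fin B → Set X} (H : Fin B → Type*)
    [∀ b, NormedAddCommGroup (H b)] [∀ b, InnerProductSpace ℝ (H b)]
    [∀ b, RKHS ℝ (H b) (R b) ℝ] (L : Y → ℝ → ℝ) (lam : Fin B → ℝ) (w : Fin B → X → ℝ)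
    (u : Measure (X × Y) → ∀ b, R b → ℝ) (P : Measure (X × Y)) : X → ℝ :=
  compose H L lam w (u P) fun b => regional (R b) P

/-- The composed predictor whose local support vector machines are learned from the regionwise
mixtures `(1 - ε) P_b + ε δ_z` (if `z ∈ R b × Y`) and `P_b` (otherwise). -/
def regionalCompPredictor {B : ℕ} {R : Fin B → Set X} (H : Fin B → Type*)
    [∀ b, NormedAddCommGroup (H b)] [∀ b, InnerProductSpace ℝ (H b)]
    [∀ b, RKHS ℝ (H b) (R b) ℝ] (L : Y → ℝ → ℝ) (lam : Fin B → ℝ) (w : Fin B → X → ℝ)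
    (u : Measure (X × Y) → ∀ b, R b → ℝ) (P : Measure (X × Y)) (z : X × Y) (ε : ℝ) : X → ℝ :=
  compose H L lam w (u (contaminate P z ε)) fun b => regionalContaminate (R b) P z ε

/-- `g` is the local influence function `IF_b(δ_z; S_b, P_b)` of the local support vector machine
`S_b : Q ↦ svm H L lam Q` on the region `A`: if `P(A × Y) > 0` and `z ∈ A × Y` it is the influence
function of `S_b` at `z` for `P_b`; regions that `δ_z` does not affect, and `P`-null
regions, have local influence function `0`. -/
def IsLocalInfluenceFunction {A : Set X} {H : Type*} [NormedAddCommGroup H]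
    [InnerProductSpace ℝ H] [RKHS ℝ H A ℝ] (L : Y → ℝ → ℝ) (lam : ℝ) (P : Measure (X × Y))
    (z : X × Y) (g : H) : Prop :=
  (∀ h : z.1 ∈ A, P (A ×ˢ univ) ≠ 0 →
    HasInfluenceFunction (svm H L lam) (regional A P) (⟨z.1, h⟩, z.2) g) ∧
  (z.1 ∉ A ∨ P (A ×ˢ univ) = 0 → g = 0)

end Regions

end LocalSVM

end

/-!
The support vector machine for `Q` is the zero of the gradient `G` of the regularized risk, a
strongly monotone Lipschitz map on the Hilbert space `H`. Contaminating `Q` by `ε δ_z` replaces `G`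
by `G + ε D`, where `D` is the gradient of the loss at `z` minus its mean under `Q`. Since strong
monotonicity makes the zero `f_ε` of `G + ε D` depend Lipschitz continuously on `ε`, differentiating
`G(f_ε) = -ε D(f_ε)` at `ε = 0` yields the influence function `-T⁻¹ (D f₀)`, with `T` the derivative
of `G` at `f₀`; its norm is bounded independently of `z` because `‖T⁻¹‖ ≤ (2 lam)⁻¹`.

The composed predictor is a sum of images of the local support vector machines under continuous
linear maps `H_b → L^∞(P^X)`, so local influence functions are carried over to it. For a point `z`
in the `b`-th region, whose mass is `p`, the regional distribution of `(1 - ε) P + ε δ_z` is the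
regional distribution of `P` contaminated with weight `ε / ((1 - ε) p + ε) ∼ ε / p`, which is where
the factors `p⁻¹` come from.
-/

namespace LocalSVM

open scoped NNReal RealInnerProductSpace
open InnerProductSpace (rankOne)

/-! ### Strongly monotone maps -/

section StronglyMonotone

variable {E : Type*} [NormedAddCommGroup E] [InnerProductSpace ℝ E]

/-- Strong monotonicity with modulus `m` of a map of a real inner product space into itself. The
gradient of a convex function plus `(m / 2) ‖·‖²` has this property. -/
def StronglyMonotone (m : ℝ) (G : E → E) : Prop :=
  ∀ f g, m * ‖f - g‖ ^ 2 ≤ ⟪G f - G g, f - g⟫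

namespace StronglyMonotone

variable {m : ℝ} {G : E → E} {K : ℝ≥0}

theorem mul_norm_sub_le (hG : StronglyMonotone m G) (f g : E) :
    m * ‖f - g‖ ≤ ‖G f - G g‖ := by
  rcases (norm_nonneg (f - g)).eq_or_lt with h0 | h0
  · simp [← h0]
  · refine le_of_mul_le_mul_right ?_ h0
    calc m * ‖f - g‖ * ‖f - g‖ = m * ‖f - g‖ ^ 2 := by ring
      _ ≤ ⟪G f - G g, f - g⟫ := hG f g
      _ ≤ ‖G f - G g‖ * ‖f - g‖ := real_inner_le_norm _ _

theorem antilipschitzWith (hG : StronglyMonotone m G) (hm : 0 < m) :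
    AntilipschitzWith (Real.toNNReal m⁻¹) G :=
  AntilipschitzWith.of_le_mul_dist fun f g => by
    rw [dist_eq_norm, dist_eq_norm, Real.coe_toNNReal _ (inv_nonneg.2 hm.le), inv_mul_eq_div,
      le_div_iff₀ hm, mul_comm]
    exact hG.mul_norm_sub_le f g

theorem injective (hG : StronglyMonotone m G) (hm : 0 < m) : Function.Injective G :=
  (hG.antilipschitzWith hm).injective

theorem norm_sub_smul_sub_le (hG : StronglyMonotone m G) (hm : 0 < m) (hK : LipschitzWith K G)
    (f g : E) :
    ‖(f - g) - (m / (K ^ 2 + m ^ 2)) • (G f - G g)‖ ≤ √(K ^ 2 / (K ^ 2 + m ^ 2)) * ‖f - g‖ := by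
  set s : ℝ := K ^ 2 + m ^ 2 with hs
  have hs0 : 0 < s := by positivity
  have hKs : (K : ℝ) ^ 2 ≤ s := le_add_of_nonneg_right (sq_nonneg m)
  have hlip : ‖G f - G g‖ ^ 2 ≤ s * ‖f - g‖ ^ 2 := calc
    ‖G f - G g‖ ^ 2 ≤ (K * ‖f - g‖) ^ 2 := by gcongr; exact hK.norm_sub_le f g
    _ ≤ s * ‖f - g‖ ^ 2 := by rw [mul_pow]; gcongr
  refine le_of_sq_le_sq ?_ (by positivity)
  calc ‖(f - g) - (m / s) • (G f - G g)‖ ^ 2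
      = ‖f - g‖ ^ 2 - 2 * (m / s * ⟪G f - G g, f - g⟫) + (m / s) ^ 2 * ‖G f - G g‖ ^ 2 := by
        rw [norm_sub_sq_real, inner_smul_right, real_inner_comm, norm_smul, mul_pow,
          Real.norm_eq_abs, sq_abs]
    _ ≤ ‖f - g‖ ^ 2 - 2 * (m / s * (m * ‖f - g‖ ^ 2)) + (m / s) ^ 2 * (s * ‖f - g‖ ^ 2) := by
        gcongr
        exact hG f g
    _ = (√(K ^ 2 / s) * ‖f - g‖) ^ 2 := by
        rw [mul_pow, Real.sq_sqrt (by positivity)]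
        field_simp
        rw [hs]
        ring

theorem surjective [CompleteSpace E] (hG : StronglyMonotone m G) (hm : 0 < m)
    (hK : LipschitzWith K G) : Function.Surjective G := by
  intro v
  set τ : ℝ := m / (K ^ 2 + m ^ 2)
  have hτ : 0 < τ := by positivity
  have hq : √((K : ℝ) ^ 2 / (K ^ 2 + m ^ 2)) < 1 := by
    rw [Real.sqrt_lt' one_pos, one_pow, div_lt_one (by positivity)]
    exact lt_add_of_pos_right _ (by positivity)
  have hcontr : ContractingWith (√((K : ℝ) ^ 2 / (K ^ 2 + m ^ 2))).toNNReal
      fun f => f - τ • (G f - v) := by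
    refine ⟨Real.toNNReal_lt_one.2 hq, LipschitzWith.of_dist_le_mul fun f g => ?_⟩
    rw [dist_eq_norm, dist_eq_norm, Real.coe_toNNReal _ (Real.sqrt_nonneg _)]
    calc ‖f - τ • (G f - v) - (g - τ • (G g - v))‖ = ‖(f - g) - τ • (G f - G g)‖ := by
          congr 1
          module
      _ ≤ _ := hG.norm_sub_smul_sub_le hm hK f g
  have : Nonempty E := ⟨0⟩
  refine ⟨hcontr.fixedPoint _, ?_⟩
  simpa [Function.IsFixedPt, hτ.ne', sub_eq_zero] using hcontr.fixedPoint_isFixedPt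

theorem of_hasFDerivAt (hG : StronglyMonotone m G) {f₀ : E} {T : E →L[ℝ] E}
    (hT : HasFDerivAt G T f₀) : StronglyMonotone m T := by
  suffices h : ∀ h, m * ‖h‖ ^ 2 ≤ ⟪T h, h⟫ from fun f g => by simpa using h (f - g)
  intro h
  have hslope := (hT.hasLineDerivAt h).tendsto_slope_zero_right.inner (𝕜 := ℝ)
    (tendsto_const_nhds (x := h))
  refine ge_of_tendsto hslope ?_
  filter_upwards [self_mem_nhdsWithin] with t (ht : 0 < t)
  rw [inner_smul_left, RCLike.conj_to_real, inv_mul_eq_div, le_div_iff₀ ht]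
  refine le_of_mul_le_mul_right ?_ ht
  calc m * ‖h‖ ^ 2 * t * t = m * ‖f₀ + t • h - f₀‖ ^ 2 := by
        rw [add_sub_cancel_left, norm_smul, mul_pow, Real.norm_eq_abs, sq_abs]
        ring
    _ ≤ ⟪G (f₀ + t • h) - G f₀, f₀ + t • h - f₀⟫ := hG _ _
    _ = ⟪G (f₀ + t • h) - G f₀, h⟫ * t := by
        rw [add_sub_cancel_left, inner_smul_right, mul_comm]

section ContinuousLinearMap

variable [CompleteSpace E] {T : E →L[ℝ] E}

theorem isInvertible (hT : StronglyMonotone m T) (hm : 0 < m) : T.IsInvertible :=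
  ⟨ContinuousLinearEquiv.ofBijective T (LinearMap.ker_eq_bot.2 (hT.injective hm))
    (LinearMap.range_eq_top.2 (hT.surjective hm T.lipschitz)),
    ContinuousLinearEquiv.coe_ofBijective _ _ _⟩

theorem norm_inverse_apply_le (hT : StronglyMonotone m T) (hm : 0 < m) (v : E) :
    ‖T.inverse v‖ ≤ ‖v‖ / m := by
  have h := hT.mul_norm_sub_le (T.inverse v) 0
  rw [map_zero, sub_zero, sub_zero, (hT.isInvertible hm).self_apply_inverse] at h
  rwa [le_div_iff₀ hm, mul_comm]

end ContinuousLinearMap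

theorem hasFDerivAt_rightInverse [CompleteSpace E] (hG : StronglyMonotone m G) (hm : 0 < m)
    {F : E → E} (hF : Function.RightInverse F G) {v : E} {T : E →L[ℝ] E}
    (hT : HasFDerivAt G T (F v)) : HasFDerivAt F T.inverse v := by
  obtain ⟨T, rfl⟩ := (hG.of_hasFDerivAt hT).isInvertible hm
  rw [ContinuousLinearMap.inverse_equiv]
  exact HasFDerivAt.of_local_left_inverse
    ((hG.antilipschitzWith hm).to_rightInverse hF).continuous.continuousAt hT
    (Eventually.of_forall hF)

theorem tendsto_inv_smul_sub_of_perturbed_zero [CompleteSpace E] (hG : StronglyMonotone m G)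
    (hm : 0 < m) (hK : LipschitzWith K G) {f₀ : E} (h₀ : G f₀ = 0) {T : E →L[ℝ] E}
    (hT : HasFDerivAt G T f₀) {D : E → E} (hD : ContinuousAt D f₀) {M : ℝ} (hM : ∀ f, ‖D f‖ ≤ M)
    {f : ℝ → E} (hf : ∀ᶠ ε in 𝓝[>] (0 : ℝ), G (f ε) + ε • D (f ε) = 0) :
    Tendsto (fun ε : ℝ => ε⁻¹ • (f ε - f₀)) (𝓝[>] 0) (𝓝 (-T.inverse (D f₀))) := by
  obtain ⟨F, hF⟩ := (hG.surjective hm hK).hasRightInverse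
  have hF₀ : F 0 = f₀ := hG.injective hm (by rw [hF, h₀])
  have hF' : HasFDerivAt F T.inverse 0 := hG.hasFDerivAt_rightInverse hm hF (hF₀.symm ▸ hT)
  -- the perturbed zero `f ε` is the value of the inverse `F` of `G` at `-ε D(f ε)`
  have hfF : ∀ᶠ ε in 𝓝[>] (0 : ℝ), F (0 + ε • -D (f ε)) = f ε := by
    filter_upwards [hf] with ε hε
    rw [zero_add, smul_neg, ← eq_neg_of_add_eq_zero_left hε]
    exact hG.injective hm (hF _)
  have hstep : Tendsto (fun ε : ℝ => ε • -D (f ε)) (𝓝[>] 0) (𝓝 0) :=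
    (tendsto_nhdsWithin_of_tendsto_nhds tendsto_id).zero_smul_isBoundedUnder_le
      (isBoundedUnder_of ⟨M, fun ε => by simpa using hM (f ε)⟩)
  have hf₀ : Tendsto f (𝓝[>] 0) (𝓝 f₀) := by
    have hstep' : Tendsto (fun ε : ℝ => 0 + ε • -D (f ε)) (𝓝[>] 0) (𝓝 0) := by
      simpa only [zero_add] using hstep
    exact hF₀ ▸ (hF'.continuousAt.tendsto.comp hstep').congr' hfF
  have hdir : Tendsto (fun ε : ℝ => ε⁻¹ • ε • -D (f ε)) (𝓝[>] 0) (𝓝 (-D f₀)) := by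
    refine (hD.tendsto.comp hf₀).neg.congr' ?_
    filter_upwards [self_mem_nhdsWithin] with ε (hε : 0 < ε)
    rw [inv_smul_smul₀ hε.ne', Function.comp_apply]
  rw [← map_neg]
  refine (hF'.hasFDerivWithinAt.lim hstep (Eventually.of_forall fun _ => mem_univ _)
    hdir).congr' ?_
  filter_upwards [hfF] with ε hε
  rw [hε, hF₀]

end StronglyMonotone

end StronglyMonotone

/-! ### Loss functions and feature maps -/

section Loss

theorem add_mul_sub_le_of_convexOn {φ : ℝ → ℝ} {s : Set ℝ} (hφ : ConvexOn ℝ s φ) {t a u : ℝ}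
    (ht : t ∈ s) (hu : u ∈ s) (ha : HasDerivAt φ a t) : φ t + a * (u - t) ≤ φ u := by
  rcases lt_trichotomy t u with h | rfl | h
  · have := hφ.le_slope_of_hasDerivAt ht hu h ha
    rw [slope_def_field, le_div_iff₀ (sub_pos.2 h)] at this
    linarith
  · simp
  · have := hφ.slope_le_of_hasDerivAt hu ht h ha
    rw [slope_def_field, div_le_iff₀ (sub_pos.2 h)] at this
    linarith

variable {Y : Type*} [MeasurableSpace Y] {L : Y → ℝ → ℝ}

theorem measurable_uncurry_deriv (hL : Measurable (Function.uncurry L))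
    (hd : ∀ y, Differentiable ℝ (L y)) : Measurable (Function.uncurry fun y => deriv (L y)) := by
  have hu : Tendsto (fun n : ℕ => 1 / ((n : ℝ) + 1)) atTop (𝓝[>] 0) :=
    tendsto_nhdsWithin_iff.2 ⟨tendsto_one_div_add_atTop_nhds_zero_nat,
      Eventually.of_forall fun _ => mem_Ioi.2 Nat.one_div_pos_of_nat⟩
  refine measurable_of_tendsto_metrizable (f := fun (n : ℕ) (p : Y × ℝ) =>
    (1 / ((n : ℝ) + 1))⁻¹ • (L p.1 (p.2 + 1 / ((n : ℝ) + 1)) - L p.1 p.2)) (fun n => ?_) ?_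
  · exact ((hL.comp (measurable_fst.prodMk (measurable_snd.add_const _))).sub hL).const_smul
      (1 / ((n : ℝ) + 1))⁻¹
  · rw [tendsto_pi_nhds]
    exact fun p => (hd p.1 p.2).hasDerivAt.tendsto_slope_zero_right.comp hu

/-- A measurable loss that is convex and twice differentiable in its last argument, with first
and second derivative bounded by `M₁` and `M₂`. -/
structure SmoothConvexLoss (L : Y → ℝ → ℝ) (M₁ M₂ : ℝ≥0) : Prop where
  measurable : Measurable (Function.uncurry L)
  convexOn : ∀ y, ConvexOn ℝ univ (L y)
  differentiable : ∀ y, Differentiable ℝ (L y)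
  differentiable_deriv : ∀ y, Differentiable ℝ (deriv (L y))
  nnnorm_deriv_le : ∀ y t, ‖deriv (L y) t‖₊ ≤ M₁
  nnnorm_deriv_deriv_le : ∀ y t, ‖deriv (deriv (L y)) t‖₊ ≤ M₂

theorem exists_smoothConvexLoss (hmeas : Measurable (Function.uncurry L))
    (hconv : ∀ y, ConvexOn ℝ univ (L y)) (hdiff : ∀ y, Differentiable ℝ (L y))
    (hdiff' : ∀ y, Differentiable ℝ (deriv (L y))) (h₁ : ⨆ y, ⨆ t, ‖deriv (L y) t‖ₑ < ∞)
    (h₂ : ⨆ y, ⨆ t, ‖deriv (deriv (L y)) t‖ₑ < ∞) : ∃ M₁ M₂, SmoothConvexLoss L M₁ M₂ := by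
  have nnnorm_le : ∀ {F : Y → ℝ → ℝ}, ⨆ y, ⨆ t, ‖F y t‖ₑ < ∞ → ∀ y t,
      ‖F y t‖₊ ≤ (⨆ y, ⨆ t, ‖F y t‖ₑ).toNNReal := fun {F} hF y t =>
    ENNReal.toNNReal_mono hF.ne (le_iSup₂ (f := fun y t => ‖F y t‖ₑ) y t)
  exact ⟨_, _, hmeas, hconv, hdiff, hdiff', nnnorm_le h₁, nnnorm_le h₂⟩

namespace SmoothConvexLoss

variable {M₁ M₂ : ℝ≥0}

theorem lipschitzWith (hL : SmoothConvexLoss L M₁ M₂) (y : Y) : LipschitzWith M₁ (L y) :=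
  lipschitzWith_of_nnnorm_deriv_le (hL.differentiable y) (hL.nnnorm_deriv_le y)

theorem add_deriv_mul_sub_le (hL : SmoothConvexLoss L M₁ M₂) (y : Y) (s t : ℝ) :
    L y s + deriv (L y) s * (t - s) ≤ L y t :=
  add_mul_sub_le_of_convexOn (hL.convexOn y) (mem_univ s) (mem_univ t)
    (hL.differentiable y s).hasDerivAt

theorem deriv_sub_mul_sub_nonneg (hL : SmoothConvexLoss L M₁ M₂) (y : Y) (s t : ℝ) :
    0 ≤ (deriv (L y) s - deriv (L y) t) * (s - t) := by
  linarith [hL.add_deriv_mul_sub_le y s t, hL.add_deriv_mul_sub_le y t s]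

end SmoothConvexLoss

end Loss

section FeatureMap

variable {X H : Type*} [NormedAddCommGroup H] [InnerProductSpace ℝ H] [CompleteSpace H]
  [RKHS ℝ H X ℝ]

variable (H) in
/-- The canonical feature map `x ↦ k(·, x)` of a reproducing kernel Hilbert space of real
functions. -/
noncomputable def featureMap (x : X) : H := RKHS.kerFun H x 1

theorem inner_featureMap (x : X) (f : H) : ⟪featureMap H x, f⟫ = f x := by
  simp [featureMap]

theorem inner_featureMap_featureMap (x y : X) :
    ⟪featureMap H x, featureMap H y⟫ = scalarKernel H x y := by
  rw [inner_featureMap, featureMap, RKHS.kerFun_apply, scalarKernel]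

theorem norm_featureMap (x : X) : ‖featureMap H x‖ = √(scalarKernel H x x) := by
  rw [norm_eq_sqrt_real_inner, inner_featureMap_featureMap]

theorem continuous_of_continuous_inner {E : Type*} [TopologicalSpace X] [NormedAddCommGroup E]
    [InnerProductSpace ℝ E] {φ : X → E} (h : Continuous fun p : X × X => ⟪φ p.1, φ p.2⟫) :
    Continuous φ := by
  refine continuous_iff_continuousAt.2 fun x => tendsto_iff_norm_sub_tendsto_zero.2 ?_
  have norm_sub_eq : ∀ y, ‖φ y - φ x‖ = √(⟪φ y, φ y⟫ - 2 * ⟪φ y, φ x⟫ + ⟪φ x, φ x⟫) := fun y => by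
    rw [real_inner_self_eq_norm_sq, real_inner_self_eq_norm_sq, ← norm_sub_sq_real,
      Real.sqrt_sq (norm_nonneg _)]
  have hdiag : Continuous fun y : X => ⟪φ y, φ y⟫ := h.comp (continuous_id.prodMk continuous_id)
  have hx : Continuous fun y : X => ⟪φ y, φ x⟫ := h.comp (continuous_id.prodMk continuous_const)
  have hnorm : Continuous fun y : X => ‖φ y - φ x‖ :=
    ((hdiag.sub (hx.const_mul 2)).add_const ⟪φ x, φ x⟫).sqrt.congr fun y => (norm_sub_eq y).symm
  exact hnorm.tendsto' x 0 (by simp)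

theorem continuous_featureMap [TopologicalSpace X]
    (hk : Continuous fun p : X × X => scalarKernel H p.1 p.2) :
    Continuous (featureMap H : X → H) :=
  continuous_of_continuous_inner
    (hk.congr fun p => (inner_featureMap_featureMap p.1 p.2).symm)

theorem stronglyMeasurable_featureMap_of_isSeparable {X : Type*} [PseudoMetricSpace X]
    [MeasurableSpace X] [OpensMeasurableSpace X] {A : Set X}
    (hA : TopologicalSpace.IsSeparable A) {H : Type*} [NormedAddCommGroup H]
    [InnerProductSpace ℝ H] [CompleteSpace H] [RKHS ℝ H A ℝ]
    (hk : Continuous fun p : A × A => scalarKernel H p.1 p.2) :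
    StronglyMeasurable (featureMap H : A → H) := by
  have := hA.separableSpace
  have := UniformSpace.secondCountable_of_separable A
  exact (continuous_featureMap hk).stronglyMeasurable

variable [MeasurableSpace X] {κ : ℝ≥0}

variable (X H) in
/-- The feature map `X → H` is strongly measurable and bounded by `κ`; the latter is
`√k(x, x) ≤ κ` in terms of the kernel. -/
structure BoundedFeature (κ : ℝ≥0) : Prop where
  stronglyMeasurable : StronglyMeasurable (featureMap H : X → H)
  norm_le : ∀ x : X, ‖featureMap H x‖ ≤ κ

theorem exists_boundedFeature (hmeas : StronglyMeasurable (featureMap H : X → H))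
    (hbdd : BddAbove (range fun x : X => √(scalarKernel H x x))) :
    ∃ κ, BoundedFeature X H κ := by
  obtain ⟨κ, hκ⟩ := hbdd
  refine ⟨κ.toNNReal, hmeas, fun x => ?_⟩
  rw [norm_featureMap]
  exact (hκ (mem_range_self x)).trans (Real.le_coe_toNNReal κ)

namespace BoundedFeature

theorem measurable_coe (hΦ : BoundedFeature X H κ) (f : H) : Measurable (f : X → ℝ) := by
  simpa only [inner_featureMap] using
    (hΦ.stronglyMeasurable.inner (𝕜 := ℝ) (stronglyMeasurable_const (b := f))).measurable

theorem norm_apply_le (hΦ : BoundedFeature X H κ) (f : H) (x : X) : ‖f x‖ ≤ κ * ‖f‖ := by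
  rw [← inner_featureMap]
  exact (norm_inner_le_norm _ _).trans (by gcongr; exact hΦ.norm_le x)

end BoundedFeature

end FeatureMap

/-! ### The gradient of the regularized risk -/

section Risk

variable {X Y : Type*} {H : Type*} [NormedAddCommGroup H] [InnerProductSpace ℝ H]
  [CompleteSpace H] [RKHS ℝ H X ℝ] {L : Y → ℝ → ℝ} {M₁ M₂ κ : ℝ≥0} {lam : ℝ}

/-- The gradient of `f ↦ L(y, f(x))` at `f ∈ H`, for `p = (x, y)`. -/
noncomputable def lossGradient (L : Y → ℝ → ℝ) (p : X × Y) (f : H) : H :=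
  deriv (L p.2) (f p.1) • featureMap H p.1

/-- The second derivative of `f ↦ L(y, f(x))` at `f ∈ H`, for `p = (x, y)`, as an operator
on `H`. -/
noncomputable def lossHessian (L : Y → ℝ → ℝ) (p : X × Y) (f : H) : H →L[ℝ] H :=
  deriv (deriv (L p.2)) (f p.1) • rankOne ℝ (featureMap H p.1) (featureMap H p.1)

theorem inner_lossGradient (p : X × Y) (f h : H) :
    ⟪lossGradient L p f, h⟫ = deriv (L p.2) (f p.1) * h p.1 := by
  rw [lossGradient, real_inner_smul_left, inner_featureMap]

variable [MeasurableSpace X] [MeasurableSpace Y] {Q : Measure (X × Y)}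

/-- The gradient of the expected loss `f ↦ ∫ L⋆(y, f(x)) dQ(x, y)`. -/
noncomputable def meanLossGradient (L : Y → ℝ → ℝ) (Q : Measure (X × Y)) (f : H) : H :=
  ∫ p, lossGradient L p f ∂Q

/-- The second derivative of the expected loss, as an operator on `H`. -/
noncomputable def meanLossHessian (L : Y → ℝ → ℝ) (Q : Measure (X × Y)) (f : H) : H →L[ℝ] H :=
  ∫ p, lossHessian L p f ∂Q

/-- The gradient of the regularized risk `regRisk`. -/
noncomputable def riskGradient (L : Y → ℝ → ℝ) (lam : ℝ) (Q : Measure (X × Y)) (f : H) : H :=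
  (2 * lam) • f + meanLossGradient L Q f

/-- The second derivative of the regularized risk, as an operator on `H`. -/
noncomputable def riskHessian (L : Y → ℝ → ℝ) (lam : ℝ) (Q : Measure (X × Y)) (f : H) :
    H →L[ℝ] H :=
  (2 * lam) • ContinuousLinearMap.id ℝ H + meanLossHessian L Q f

namespace SmoothConvexLoss

omit [MeasurableSpace X] in
theorem hasFDerivAt_lossGradient (hL : SmoothConvexLoss L M₁ M₂) (p : X × Y) (f : H) :
    HasFDerivAt (lossGradient L p) (lossHessian L p f) f := by
  have heval : HasFDerivAt (fun f : H => f p.1) (innerSL ℝ (featureMap H p.1)) f :=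
    (innerSL ℝ (featureMap H p.1)).hasFDerivAt.congr_of_eventuallyEq
      (Eventually.of_forall fun g => (inner_featureMap p.1 g).symm)
  refine (((hL.differentiable_deriv p.2 (f p.1)).hasDerivAt.comp_hasFDerivAt f heval).smul_const
    (featureMap H p.1)).congr_fderiv (ContinuousLinearMap.ext fun h => ?_)
  simp [lossHessian, smul_smul]

theorem norm_lossGradient_le (hL : SmoothConvexLoss L M₁ M₂) (hΦ : BoundedFeature X H κ)
    (p : X × Y) (f : H) : ‖lossGradient L p f‖ ≤ M₁ * κ := by
  rw [lossGradient, norm_smul]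
  gcongr
  exacts [hL.nnnorm_deriv_le _ _, hΦ.norm_le _]

theorem norm_lossHessian_le (hL : SmoothConvexLoss L M₁ M₂) (hΦ : BoundedFeature X H κ)
    (p : X × Y) (f : H) : ‖lossHessian L p f‖ ≤ M₂ * (κ * κ) := by
  rw [lossHessian, norm_smul, InnerProductSpace.norm_rankOne]
  gcongr
  exacts [hL.nnnorm_deriv_deriv_le _ _, hΦ.norm_le _, hΦ.norm_le _]

theorem lipschitzWith_lossGradient (hL : SmoothConvexLoss L M₁ M₂) (hΦ : BoundedFeature X H κ)
    (p : X × Y) : LipschitzWith (M₂ * (κ * κ)) (lossGradient L p : H → H) :=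
  lipschitzWith_of_nnnorm_fderiv_le (fun f => (hL.hasFDerivAt_lossGradient p f).differentiableAt)
    fun f => by
      rw [(hL.hasFDerivAt_lossGradient p f).fderiv]
      exact_mod_cast hL.norm_lossHessian_le hΦ p f

theorem stronglyMeasurable_lossGradient (hL : SmoothConvexLoss L M₁ M₂)
    (hΦ : BoundedFeature X H κ) (f : H) :
    StronglyMeasurable fun p : X × Y => lossGradient L p f :=
  ((measurable_uncurry_deriv hL.measurable hL.differentiable).comp
    (measurable_snd.prodMk ((hΦ.measurable_coe f).comp measurable_fst))).stronglyMeasurable.smul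
    (hΦ.stronglyMeasurable.comp_measurable measurable_fst)

theorem stronglyMeasurable_lossHessian (hL : SmoothConvexLoss L M₁ M₂)
    (hΦ : BoundedFeature X H κ) (f : H) :
    StronglyMeasurable fun p : X × Y => lossHessian L p f := by
  have hderiv := measurable_uncurry_deriv
    (measurable_uncurry_deriv hL.measurable hL.differentiable) hL.differentiable_deriv
  have hrankOne : Continuous fun v : H => rankOne ℝ v v :=
    (rankOne ℝ).continuous.clm_apply continuous_id
  exact (hderiv.comp
    (measurable_snd.prodMk ((hΦ.measurable_coe f).comp measurable_fst))).stronglyMeasurable.smul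
    (hrankOne.comp_stronglyMeasurable (hΦ.stronglyMeasurable.comp_measurable measurable_fst))

variable [IsFiniteMeasure Q]

theorem integrable_lossGradient (hL : SmoothConvexLoss L M₁ M₂) (hΦ : BoundedFeature X H κ)
    (f : H) : Integrable (fun p : X × Y => lossGradient L p f) Q :=
  Integrable.of_bound (hL.stronglyMeasurable_lossGradient hΦ f).aestronglyMeasurable (M₁ * κ)
    (Eventually.of_forall fun p => hL.norm_lossGradient_le hΦ p f)

theorem integrable_shiftedLoss (hL : SmoothConvexLoss L M₁ M₂) (hΦ : BoundedFeature X H κ)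
    (f : H) : Integrable (fun p : X × Y => shiftedLoss L p.2 (f p.1)) Q := by
  have hmeas : Measurable fun p : X × Y => shiftedLoss L p.2 (f p.1) :=
    (hL.measurable.comp (measurable_snd.prodMk ((hΦ.measurable_coe f).comp measurable_fst))).sub
      (hL.measurable.comp (measurable_snd.prodMk measurable_const))
  refine Integrable.of_bound hmeas.aestronglyMeasurable (M₁ * (κ * ‖f‖))
    (Eventually.of_forall fun p => ?_)
  calc ‖shiftedLoss L p.2 (f p.1)‖ ≤ M₁ * ‖f p.1 - 0‖ := (hL.lipschitzWith p.2).norm_sub_le _ _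
    _ ≤ M₁ * (κ * ‖f‖) := by
      rw [sub_zero]
      gcongr
      exact hΦ.norm_apply_le f p.1

theorem meanLossGradient_sub (hL : SmoothConvexLoss L M₁ M₂) (hΦ : BoundedFeature X H κ)
    (f g : H) : meanLossGradient L Q f - meanLossGradient L Q g =
      ∫ p, (lossGradient L p f - lossGradient L p g) ∂Q :=
  (integral_sub (hL.integrable_lossGradient hΦ f) (hL.integrable_lossGradient hΦ g)).symm

theorem norm_meanLossGradient_le {Q : Measure (X × Y)} [IsProbabilityMeasure Q]
    (hL : SmoothConvexLoss L M₁ M₂) (hΦ : BoundedFeature X H κ) (f : H) :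
    ‖meanLossGradient L Q f‖ ≤ M₁ * κ := by
  simpa [meanLossGradient] using norm_integral_le_of_norm_le_const (μ := Q)
    (Eventually.of_forall fun p => hL.norm_lossGradient_le hΦ p f)

theorem lipschitzWith_meanLossGradient (hL : SmoothConvexLoss L M₁ M₂)
    (hΦ : BoundedFeature X H κ) :
    LipschitzWith (M₂ * (κ * κ) * measureUnivNNReal Q) (meanLossGradient L Q : H → H) :=
  LipschitzWith.of_dist_le_mul fun f g => by
    rw [dist_eq_norm, dist_eq_norm, hL.meanLossGradient_sub hΦ]
    refine (norm_integral_le_of_norm_le_const (Eventually.of_forall fun p =>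
      (hL.lipschitzWith_lossGradient hΦ p).norm_sub_le f g)).trans_eq ?_
    simp only [measureReal_def, NNReal.coe_mul, measureUnivNNReal, ENNReal.coe_toNNReal_eq_toReal]
    ring

theorem stronglyMonotone_zero_meanLossGradient (hL : SmoothConvexLoss L M₁ M₂)
    (hΦ : BoundedFeature X H κ) : StronglyMonotone 0 (meanLossGradient L Q : H → H) := by
  intro f g
  have hint : Integrable (fun p => lossGradient L p f - lossGradient L p g) Q :=
    (hL.integrable_lossGradient hΦ f).sub (hL.integrable_lossGradient hΦ g)
  rw [zero_mul, hL.meanLossGradient_sub hΦ, real_inner_comm, ← integral_inner hint]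
  refine integral_nonneg fun p => ?_
  simp only [Pi.zero_apply]
  rw [real_inner_comm, inner_sub_left, inner_lossGradient, inner_lossGradient, ← sub_mul]
  simpa using hL.deriv_sub_mul_sub_nonneg p.2 (f p.1) (g p.1)

theorem hasFDerivAt_meanLossGradient (hL : SmoothConvexLoss L M₁ M₂) (hΦ : BoundedFeature X H κ)
    (f : H) : HasFDerivAt (meanLossGradient L Q) (meanLossHessian L Q f) f :=
  hasFDerivAt_integral_of_dominated_of_fderiv_le (bound := fun _ => M₂ * (κ * κ)) univ_mem
    (Eventually.of_forall fun g => (hL.stronglyMeasurable_lossGradient hΦ g).aestronglyMeasurable)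
    (hL.integrable_lossGradient hΦ f)
    (hL.stronglyMeasurable_lossHessian hΦ f).aestronglyMeasurable
    (Eventually.of_forall fun p g _ => hL.norm_lossHessian_le hΦ p g) (integrable_const _)
    (Eventually.of_forall fun p g _ => hL.hasFDerivAt_lossGradient p g)

theorem lipschitzWith_riskGradient (hL : SmoothConvexLoss L M₁ M₂) (hΦ : BoundedFeature X H κ) :
    LipschitzWith (‖2 * lam‖₊ + M₂ * (κ * κ) * measureUnivNNReal Q)
      (riskGradient L lam Q : H → H) :=
  (lipschitzWith_smul (2 * lam)).add (hL.lipschitzWith_meanLossGradient hΦ)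

theorem stronglyMonotone_riskGradient (hL : SmoothConvexLoss L M₁ M₂)
    (hΦ : BoundedFeature X H κ) :
    StronglyMonotone (2 * lam) (riskGradient L lam Q : H → H) := fun f g => by
  rw [riskGradient, riskGradient, add_sub_add_comm, ← smul_sub, inner_add_left,
    real_inner_smul_left, real_inner_self_eq_norm_sq]
  simpa using hL.stronglyMonotone_zero_meanLossGradient hΦ f g

theorem hasFDerivAt_riskGradient (hL : SmoothConvexLoss L M₁ M₂) (hΦ : BoundedFeature X H κ)
    (f : H) : HasFDerivAt (riskGradient L lam Q) (riskHessian L lam Q f) f :=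
  ((hasFDerivAt_id f).const_smul (2 * lam)).add (hL.hasFDerivAt_meanLossGradient hΦ f)

theorem stronglyMonotone_riskHessian (hL : SmoothConvexLoss L M₁ M₂) (hΦ : BoundedFeature X H κ)
    (f : H) : StronglyMonotone (2 * lam) (riskHessian L lam Q f) :=
  (hL.stronglyMonotone_riskGradient hΦ).of_hasFDerivAt (hL.hasFDerivAt_riskGradient hΦ f)

theorem regRisk_add_inner_add_le (hL : SmoothConvexLoss L M₁ M₂) (hΦ : BoundedFeature X H κ)
    (f h : H) :
    regRisk L Q lam f + ⟪riskGradient L lam Q f, h - f⟫ + lam * ‖h - f‖ ^ 2 ≤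
      regRisk L Q lam h := by
  have hloss : ∫ p, shiftedLoss L p.2 (f p.1) ∂Q + ⟪meanLossGradient L Q f, h - f⟫ ≤
      ∫ p, shiftedLoss L p.2 (h p.1) ∂Q := by
    have hint := (hL.integrable_lossGradient (Q := Q) hΦ f).const_inner (𝕜 := ℝ) (h - f)
    rw [meanLossGradient, real_inner_comm, ← integral_inner (hL.integrable_lossGradient hΦ f),
      ← integral_add (hL.integrable_shiftedLoss hΦ f) hint]
    refine integral_mono ((hL.integrable_shiftedLoss hΦ f).add hint)
      (hL.integrable_shiftedLoss hΦ h) fun p => ?_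
    have htangent := hL.add_deriv_mul_sub_le p.2 (f p.1) (h p.1)
    have hinner : ⟪h - f, lossGradient L p f⟫ = deriv (L p.2) (f p.1) * (h p.1 - f p.1) := by
      rw [real_inner_comm, inner_lossGradient, RKHS.coe_sub, Pi.sub_apply]
    simp only [shiftedLoss, hinner]
    linarith
  have hsq : ‖h‖ ^ 2 = ‖f‖ ^ 2 + 2 * ⟪f, h - f⟫ + ‖h - f‖ ^ 2 := by
    rw [← norm_add_sq_real, add_sub_cancel]
  rw [regRisk, regRisk, riskGradient, inner_add_left, real_inner_smul_left, hsq]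
  linarith

theorem exists_riskGradient_eq_zero (hL : SmoothConvexLoss L M₁ M₂) (hΦ : BoundedFeature X H κ)
    (hlam : 0 < lam) : ∃ f : H, riskGradient L lam Q f = 0 :=
  (hL.stronglyMonotone_riskGradient hΦ).surjective (mul_pos two_pos hlam)
    (hL.lipschitzWith_riskGradient hΦ) 0

theorem isSVM_iff_riskGradient_eq_zero (hL : SmoothConvexLoss L M₁ M₂)
    (hΦ : BoundedFeature X H κ) (hlam : 0 < lam) {f : H} :
    IsSVM L Q lam f ↔ riskGradient L lam Q f = 0 := by
  have hgap : ∀ g : H, riskGradient L lam Q g = 0 → ∀ h : H,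
      regRisk L Q lam g + lam * ‖h - g‖ ^ 2 ≤ regRisk L Q lam h := fun g hg h => by
    simpa [hg] using hL.regRisk_add_inner_add_le (lam := lam) (Q := Q) hΦ g h
  refine ⟨fun hf => ?_, fun hf h => ?_⟩
  · obtain ⟨g, hg⟩ := hL.exists_riskGradient_eq_zero (Q := Q) hΦ hlam
    have hsq : ‖f - g‖ ^ 2 ≤ 0 :=
      nonpos_of_mul_nonpos_right (by linarith [hgap g hg f, hf g]) hlam
    rwa [sub_eq_zero.1 (norm_eq_zero.1 (pow_eq_zero_iff two_ne_zero |>.1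
      (hsq.antisymm (sq_nonneg _))))]
  · exact (le_add_of_nonneg_right (by positivity)).trans (hgap f hf h)

theorem existsUnique_isSVM (hL : SmoothConvexLoss L M₁ M₂) (hΦ : BoundedFeature X H κ)
    (hlam : 0 < lam) : ∃! f : H, IsSVM L Q lam f := by
  simp only [hL.isSVM_iff_riskGradient_eq_zero hΦ hlam]
  exact existsUnique_of_exists_of_unique (hL.exists_riskGradient_eq_zero hΦ hlam) fun f g hf hg =>
    (hL.stronglyMonotone_riskGradient hΦ).injective (mul_pos two_pos hlam) (hf.trans hg.symm)

theorem riskGradient_svm (hL : SmoothConvexLoss L M₁ M₂) (hΦ : BoundedFeature X H κ)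
    (hlam : 0 < lam) : riskGradient L lam Q (svm H L lam Q) = 0 :=
  (hL.isSVM_iff_riskGradient_eq_zero hΦ hlam).1
    (Classical.epsilon_spec (hL.existsUnique_isSVM hΦ hlam).exists)

end SmoothConvexLoss

end Risk

/-! ### Influence functions of support vector machines -/

section Contaminate

variable {M : Type*} [MeasurableSpace M]

theorem contaminate_apply (P : Measure M) (z : M) (ε : ℝ) (s : Set M) :
    contaminate P z ε s = ENNReal.ofReal (1 - ε) * P s + ENNReal.ofReal ε * Measure.dirac z s := by
  rw [contaminate, Measure.add_apply, Measure.smul_apply, Measure.smul_apply, smul_eq_mul,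
    smul_eq_mul]

theorem contaminate_apply_ne_zero {P : Measure M} (z : M) {ε : ℝ} (hε : ε < 1) {s : Set M}
    (hs : P s ≠ 0) : contaminate P z ε s ≠ 0 := by
  rw [contaminate_apply]
  simp [hs, hε]

theorem isFiniteMeasure_contaminate (P : Measure M) [IsFiniteMeasure P] (z : M) (ε : ℝ) :
    IsFiniteMeasure (contaminate P z ε) := by
  have := Measure.smul_finite P (ENNReal.ofReal_ne_top (r := 1 - ε))
  have := Measure.smul_finite (Measure.dirac z) (ENNReal.ofReal_ne_top (r := ε))
  rw [contaminate]
  infer_instance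

theorem isProbabilityMeasure_contaminate (P : Measure M) [IsProbabilityMeasure P] (z : M) {ε : ℝ}
    (hε : ε ∈ Icc (0 : ℝ) 1) : IsProbabilityMeasure (contaminate P z ε) := by
  refine ⟨?_⟩
  rw [contaminate_apply, measure_univ, measure_univ, mul_one, mul_one,
    ← ENNReal.ofReal_add (sub_nonneg.2 hε.2) hε.1, sub_add_cancel, ENNReal.ofReal_one]

theorem integral_contaminate {E : Type*} [NormedAddCommGroup E] [NormedSpace ℝ E]
    [CompleteSpace E] {P : Measure M} {z : M} {ε : ℝ} (hε : ε ∈ Icc (0 : ℝ) 1) {f : M → E}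
    (hf : StronglyMeasurable f) (hfP : Integrable f P) :
    ∫ p, f p ∂contaminate P z ε = (1 - ε) • ∫ p, f p ∂P + ε • f z := by
  rw [contaminate, integral_add_measure (hfP.smul_measure ENNReal.ofReal_ne_top)
    ((integrable_dirac' hf enorm_lt_top).smul_measure ENNReal.ofReal_ne_top),
    integral_smul_measure, integral_smul_measure, integral_dirac' _ _ hf,
    ENNReal.toReal_ofReal hε.1, ENNReal.toReal_ofReal (sub_nonneg.2 hε.2)]

end Contaminate

section SVMInfluence

variable {X Y : Type*} [MeasurableSpace X] [MeasurableSpace Y] {H : Type*} [NormedAddCommGroup H]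
  [InnerProductSpace ℝ H] [CompleteSpace H] [RKHS ℝ H X ℝ] {L : Y → ℝ → ℝ} {M₁ M₂ κ : ℝ≥0}
  {lam : ℝ}

/-- The influence function of the support vector machine at `z` for `Q`: minus the inverse Hessian
of the regularized risk, applied to the centered gradient of the loss at `z`. -/
noncomputable def svmInfluence (H : Type*) [NormedAddCommGroup H] [InnerProductSpace ℝ H]
    [CompleteSpace H] [RKHS ℝ H X ℝ] (L : Y → ℝ → ℝ) (lam : ℝ) (Q : Measure (X × Y))
    (z : X × Y) : H :=
  -(riskHessian L lam Q (svm H L lam Q)).inverse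
    (lossGradient L z (svm H L lam Q) - meanLossGradient L Q (svm H L lam Q))

namespace SmoothConvexLoss

variable {Q : Measure (X × Y)} [IsProbabilityMeasure Q]

theorem riskGradient_contaminate (hL : SmoothConvexLoss L M₁ M₂) (hΦ : BoundedFeature X H κ)
    (z : X × Y) {ε : ℝ} (hε : ε ∈ Icc (0 : ℝ) 1) (f : H) :
    riskGradient L lam (contaminate Q z ε) f =
      riskGradient L lam Q f + ε • (lossGradient L z f - meanLossGradient L Q f) := by
  simp only [riskGradient, meanLossGradient, integral_contaminate hε
    (hL.stronglyMeasurable_lossGradient hΦ f) (hL.integrable_lossGradient hΦ f)]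
  module

theorem norm_lossGradient_sub_meanLossGradient_le (hL : SmoothConvexLoss L M₁ M₂)
    (hΦ : BoundedFeature X H κ) (z : X × Y) (f : H) :
    ‖lossGradient L z f - meanLossGradient L Q f‖ ≤ 2 * (M₁ * κ) := by
  rw [two_mul]
  exact norm_sub_le_of_le (hL.norm_lossGradient_le hΦ z f) (hL.norm_meanLossGradient_le hΦ f)

theorem hasInfluenceFunction_svm (hL : SmoothConvexLoss L M₁ M₂) (hΦ : BoundedFeature X H κ)
    (hlam : 0 < lam) (z : X × Y) :
    HasInfluenceFunction (svm H L lam) Q z (svmInfluence H L lam Q z) := by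
  refine (hL.stronglyMonotone_riskGradient hΦ).tendsto_inv_smul_sub_of_perturbed_zero
    (mul_pos two_pos hlam) (hL.lipschitzWith_riskGradient hΦ) (hL.riskGradient_svm hΦ hlam)
    (hL.hasFDerivAt_riskGradient hΦ _)
    (D := fun f => lossGradient L z f - meanLossGradient L Q f) ?_
    (hL.norm_lossGradient_sub_meanLossGradient_le hΦ z) ?_
  · exact (hL.hasFDerivAt_lossGradient z _).continuousAt.sub
      (hL.hasFDerivAt_meanLossGradient hΦ _).continuousAt
  · filter_upwards [Ioc_mem_nhdsGT one_pos] with ε hε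
    have hε' : ε ∈ Icc (0 : ℝ) 1 := Ioc_subset_Icc_self hε
    have := isProbabilityMeasure_contaminate Q z hε'
    rw [← hL.riskGradient_contaminate hΦ z hε']
    exact hL.riskGradient_svm hΦ hlam

theorem norm_svmInfluence_le (hL : SmoothConvexLoss L M₁ M₂) (hΦ : BoundedFeature X H κ)
    (hlam : 0 < lam) (z : X × Y) : ‖svmInfluence H L lam Q z‖ ≤ M₁ * κ / lam := by
  rw [svmInfluence, norm_neg, ← mul_div_mul_left _ _ two_ne_zero]
  refine ((hL.stronglyMonotone_riskHessian hΦ _).norm_inverse_apply_le (mul_pos two_pos hlam)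
    _).trans ?_
  gcongr
  exact hL.norm_lossGradient_sub_meanLossGradient_le hΦ z _

end SmoothConvexLoss

end SVMInfluence

/-! ### Regional distributions -/

theorem comap_dirac_apply {α β : Type*} [MeasurableSpace α] [MeasurableSpace β] {e : α → β}
    (he : MeasurableEmbedding e) (a : α) :
    (Measure.dirac (e a)).comap e = Measure.dirac a := by
  rw [← Measure.map_dirac' he.measurable, he.comap_map]

theorem comap_dirac_of_notMem_range {α β : Type*} [MeasurableSpace α] [MeasurableSpace β]
    {e : α → β} (he : MeasurableEmbedding e) {b : β} (hb : b ∉ range e) :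
    (Measure.dirac b).comap e = 0 := by
  rw [← Measure.measure_univ_eq_zero, he.comap_apply, image_univ,
    Measure.dirac_apply' _ he.measurableSet_range, indicator_of_notMem hb]

theorem comap_contaminate {α β : Type*} [MeasurableSpace α] [MeasurableSpace β] {e : α → β}
    (he : MeasurableEmbedding e) (P : Measure β) (z : β) (ε : ℝ) :
    (contaminate P z ε).comap e =
      ENNReal.ofReal (1 - ε) • P.comap e + ENNReal.ofReal ε • (Measure.dirac z).comap e := by
  rw [contaminate, he.comap_add, Measure.comap_smul, Measure.comap_smul]

section Regional

variable {X Y : Type*} [MeasurableSpace X] [MeasurableSpace Y] {A : Set X} {P : Measure (X × Y)}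

theorem measurableEmbedding_region (hA : MeasurableSet A) :
    MeasurableEmbedding fun p : A × Y => ((p.1 : X), p.2) :=
  (MeasurableEmbedding.subtype_coe hA).prodMap MeasurableEmbedding.id

omit [MeasurableSpace X] [MeasurableSpace Y] in
theorem range_region : range (fun p : A × Y => ((p.1 : X), p.2)) = A ×ˢ univ := by
  ext ⟨x, y⟩
  simp

theorem isProbabilityMeasure_regional [IsFiniteMeasure P] (hA : MeasurableSet A)
    (h0 : P (A ×ˢ univ) ≠ 0) : IsProbabilityMeasure (regional A P) := by
  refine ⟨?_⟩
  rw [regional, Measure.smul_apply, (measurableEmbedding_region hA).comap_apply, image_univ,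
    range_region, smul_eq_mul, ENNReal.inv_mul_cancel h0 (measure_ne_top _ _)]

theorem isProbabilityMeasure_regionalContaminate [IsFiniteMeasure P] (hA : MeasurableSet A)
    (h0 : P (A ×ˢ univ) ≠ 0) (z : X × Y) {ε : ℝ} (hε : ε ∈ Icc (0 : ℝ) 1) :
    IsProbabilityMeasure (regionalContaminate A P z ε) := by
  have := isProbabilityMeasure_regional hA h0
  rw [regionalContaminate]
  split_ifs
  · exact isProbabilityMeasure_contaminate _ _ hε
  · exact this

theorem isProbabilityMeasure_regional_contaminate [IsFiniteMeasure P] (hA : MeasurableSet A)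
    (h0 : P (A ×ˢ univ) ≠ 0) (z : X × Y) {ε : ℝ} (hε : ε < 1) :
    IsProbabilityMeasure (regional A (contaminate P z ε)) :=
  have := isFiniteMeasure_contaminate P z ε
  isProbabilityMeasure_regional hA (contaminate_apply_ne_zero z hε h0)

theorem regional_contaminate_of_notMem (hA : MeasurableSet A) {z : X × Y} (hz : z.1 ∉ A) {ε : ℝ}
    (hε : ε < 1) : regional A (contaminate P z ε) = regional A P := by
  have hc : ENNReal.ofReal (1 - ε) ≠ 0 := by simpa using hε
  have hzA : z ∉ A ×ˢ (univ : Set Y) := fun h => hz h.1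
  have hmass : contaminate P z ε (A ×ˢ univ) = ENNReal.ofReal (1 - ε) * P (A ×ˢ univ) := by
    rw [contaminate_apply, Measure.dirac_apply' _ (hA.prod .univ), indicator_of_notMem hzA,
      mul_zero, add_zero]
  rw [regional, regional, hmass, comap_contaminate (measurableEmbedding_region hA),
    comap_dirac_of_notMem_range (measurableEmbedding_region hA) (range_region ▸ hzA), smul_zero,
    add_zero, smul_smul, ENNReal.mul_inv (.inl hc) (.inl ENNReal.ofReal_ne_top), mul_right_comm,
    ENNReal.inv_mul_cancel hc ENNReal.ofReal_ne_top, one_mul]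

theorem regional_contaminate_of_mem [IsFiniteMeasure P] (hA : MeasurableSet A) {z : X × Y}
    (hz : z.1 ∈ A) (h0 : P (A ×ˢ univ) ≠ 0) {ε : ℝ} (hε : ε ∈ Ico (0 : ℝ) 1) :
    regional A (contaminate P z ε) = contaminate (regional A P) (⟨z.1, hz⟩, z.2)
      (ε / ((1 - ε) * P.real (A ×ˢ univ) + ε)) := by
  have hp : 0 < P.real (A ×ˢ univ) := ENNReal.toReal_pos h0 (measure_ne_top _ _)
  have hPp : P (A ×ˢ univ) = ENNReal.ofReal (P.real (A ×ˢ univ)) :=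
    (ENNReal.ofReal_toReal (measure_ne_top _ _)).symm
  set p : ℝ := P.real (A ×ˢ univ)
  have hε1 : 0 < 1 - ε := sub_pos.2 hε.2
  have hq : 0 < (1 - ε) * p + ε := add_pos_of_pos_of_nonneg (mul_pos hε1 hp) hε.1
  have hmass : contaminate P z ε (A ×ˢ univ) = ENNReal.ofReal ((1 - ε) * p + ε) := by
    rw [contaminate_apply, hPp, Measure.dirac_apply_of_mem (mk_mem_prod hz (mem_univ z.2)),
      mul_one, ← ENNReal.ofReal_mul hε1.le, ← ENNReal.ofReal_add (by positivity) hε.1]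
  have hweight : 1 - ε / ((1 - ε) * p + ε) = ((1 - ε) * p + ε)⁻¹ * (1 - ε) * p := by
    field_simp
    ring
  have hdirac := comap_dirac_apply (measurableEmbedding_region (Y := Y) hA) (⟨z.1, hz⟩, z.2)
  rw [regional, hmass, comap_contaminate (measurableEmbedding_region hA), hdirac, contaminate,
    regional, hPp, hweight, smul_add, smul_smul, smul_smul, smul_smul,
    ← ENNReal.ofReal_inv_of_pos hq, ← ENNReal.ofReal_inv_of_pos hp,
    ← ENNReal.ofReal_mul (by positivity), ← ENNReal.ofReal_mul (by positivity),
    ← ENNReal.ofReal_mul (by positivity), mul_inv_cancel_right₀ hp.ne', inv_mul_eq_div _ ε]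

end Regional

theorem HasInfluenceFunction.tendsto_reweighted {M E : Type*} [MeasurableSpace M]
    [NormedAddCommGroup E] [NormedSpace ℝ E] {S : Measure M → E} {P : Measure M} {z : M} {g : E}
    (h : HasInfluenceFunction S P z g) {p : ℝ} (hp : 0 < p) :
    Tendsto (fun ε : ℝ => ε⁻¹ • (S (contaminate P z (ε / ((1 - ε) * p + ε))) - S P)) (𝓝[>] 0)
      (𝓝 (p⁻¹ • g)) := by
  have hε : Tendsto (fun ε : ℝ => ε) (𝓝[>] 0) (𝓝 0) := nhdsWithin_le_nhds
  have hq : Tendsto (fun ε : ℝ => (1 - ε) * p + ε) (𝓝[>] 0) (𝓝 p) := by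
    have hcont : Continuous fun ε : ℝ => (1 - ε) * p + ε := by fun_prop
    exact (hcont.tendsto' 0 p (by simp)).comp hε
  have hpos : ∀ᶠ ε in 𝓝[>] (0 : ℝ), 0 < ε ∧ 0 < (1 - ε) * p + ε :=
    (eventually_mem_nhdsWithin (a := (0 : ℝ)) (s := Ioi 0)).and (hq.eventually_const_lt hp)
  have hweight : Tendsto (fun ε : ℝ => ε / ((1 - ε) * p + ε)) (𝓝[>] 0) (𝓝[>] 0) :=
    tendsto_nhdsWithin_iff.2 ⟨by simpa only [zero_div, Pi.div_def] using hε.div hq hp.ne',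
      hpos.mono fun ε h => div_pos h.1 h.2⟩
  refine ((hq.inv₀ hp.ne').smul (h.comp hweight)).congr' ?_
  filter_upwards [hpos] with ε hε
  rw [Function.comp_apply, smul_smul, inv_div, inv_mul_eq_div, div_div_cancel_left' hε.2.ne']

section LocalInfluence

variable {X Y : Type*} [MeasurableSpace X] [MeasurableSpace Y] {A : Set X} {L : Y → ℝ → ℝ}
  {M₁ M₂ κ : ℝ≥0} {lam : ℝ} {P : Measure (X × Y)} {z : X × Y} {H : Type*} [NormedAddCommGroup H]
  [InnerProductSpace ℝ H] [RKHS ℝ H A ℝ]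

namespace IsLocalInfluenceFunction

variable {g : H}

theorem tendsto_regionalContaminate (hg : IsLocalInfluenceFunction L lam P z g)
    (h0 : P (A ×ˢ univ) ≠ 0) :
    Tendsto (fun ε : ℝ => ε⁻¹ •
      (svm H L lam (regionalContaminate A P z ε) - svm H L lam (regional A P))) (𝓝[>] 0)
      (𝓝 g) := by
  by_cases hz : z.1 ∈ A
  · simp only [regionalContaminate, dif_pos hz]
    exact hg.1 hz h0
  · simp [regionalContaminate, hz, hg.2 (.inl hz)]

theorem tendsto_regional_contaminate [IsFiniteMeasure P] (hA : MeasurableSet A)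
    (hg : IsLocalInfluenceFunction L lam P z g) (h0 : P (A ×ˢ univ) ≠ 0) :
    Tendsto (fun ε : ℝ => ε⁻¹ •
      (svm H L lam (regional A (contaminate P z ε)) - svm H L lam (regional A P))) (𝓝[>] 0)
      (𝓝 ((P.real (A ×ˢ univ))⁻¹ • g)) := by
  by_cases hz : z.1 ∈ A
  · have hp : 0 < P.real (A ×ˢ univ) := ENNReal.toReal_pos h0 (measure_ne_top _ _)
    refine ((hg.1 hz h0).tendsto_reweighted hp).congr' ?_
    filter_upwards [Ioo_mem_nhdsGT one_pos] with ε hε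
    rw [regional_contaminate_of_mem hA hz h0 (Ioo_subset_Ico_self hε)]
  · rw [hg.2 (.inl hz), smul_zero]
    refine tendsto_const_nhds.congr' ?_
    filter_upwards [Ioo_mem_nhdsGT one_pos] with ε hε
    rw [regional_contaminate_of_notMem hA hz hε.2, sub_self, smul_zero]

end IsLocalInfluenceFunction

variable [CompleteSpace H]

open Classical in
/-- The local influence function of the support vector machine on the region `A`, extended by `0`
to points outside the region and to `P`-null regions. -/
noncomputable def localInfluence (H : Type*) [NormedAddCommGroup H] [InnerProductSpace ℝ H]
    [CompleteSpace H] [RKHS ℝ H A ℝ] (L : Y → ℝ → ℝ) (lam : ℝ) (P : Measure (X × Y))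
    (z : X × Y) : H :=
  if h : z.1 ∈ A ∧ P (A ×ˢ univ) ≠ 0 then
    svmInfluence H L lam (regional A P) (⟨z.1, h.1⟩, z.2) else 0

variable [IsFiniteMeasure P]

theorem isLocalInfluenceFunction_localInfluence (hL : SmoothConvexLoss L M₁ M₂)
    (hA : MeasurableSet A) (hΦ : BoundedFeature A H κ) (hlam : 0 < lam) (z : X × Y) :
    IsLocalInfluenceFunction L lam P z (localInfluence H L lam P z) := by
  refine ⟨fun hz h0 => ?_, fun h => dif_neg (by tauto)⟩
  have := isProbabilityMeasure_regional hA h0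
  rw [localInfluence, dif_pos ⟨hz, h0⟩]
  exact hL.hasInfluenceFunction_svm hΦ hlam _

theorem norm_localInfluence_le (hL : SmoothConvexLoss L M₁ M₂) (hA : MeasurableSet A)
    (hΦ : BoundedFeature A H κ) (hlam : 0 < lam) (z : X × Y) :
    ‖localInfluence H L lam P z‖ ≤ M₁ * κ / lam := by
  rw [localInfluence]
  split_ifs with h
  · have := isProbabilityMeasure_regional hA h.2
    exact hL.norm_svmInfluence_le hΦ hlam _
  · rw [norm_zero]
    positivity

end LocalInfluence

/-! ### Composed predictors -/

section WeightedRegion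

variable {X : Type*} {A : Set X}

theorem extendZero_of_notMem {f : A → ℝ} {x : X} (hx : x ∉ A) : extendZero f x = 0 :=
  dif_neg hx

theorem measurable_extendZero [MeasurableSpace X] (hA : MeasurableSet A) {f : A → ℝ}
    (hf : Measurable f) : Measurable (extendZero f) := by
  classical
  exact Measurable.dite (g := fun _ => (0 : ℝ)) hf measurable_const hA

variable {H : Type*} [NormedAddCommGroup H] [InnerProductSpace ℝ H] [RKHS ℝ H A ℝ]

theorem extendZero_coe_add (f g : H) (x : X) :
    extendZero (⇑(f + g)) x = extendZero (f : A → ℝ) x + extendZero (g : A → ℝ) x := by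
  by_cases hx : x ∈ A <;> simp [extendZero, hx]

theorem extendZero_coe_smul (c : ℝ) (f : H) (x : X) :
    extendZero (⇑(c • f)) x = c * extendZero (f : A → ℝ) x := by
  by_cases hx : x ∈ A <;> simp [extendZero, hx]

variable [CompleteSpace H] [MeasurableSpace X] {w : X → ℝ} {κ W : ℝ≥0}

variable (A H) in
/-- A measurable region `A` carrying a reproducing kernel Hilbert space `H` with feature map
bounded by `κ`, together with a measurable weight `w` bounded by `W`. -/
structure IsWeightedRegion (w : X → ℝ) (κ W : ℝ≥0) : Prop where
  measurableSet : MeasurableSet A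
  boundedFeature : BoundedFeature A H κ
  measurable_weight : Measurable w
  norm_weight_le : ∀ x, ‖w x‖ ≤ W

namespace IsWeightedRegion

theorem norm_mul_extendZero_le (hA : IsWeightedRegion A H w κ W) (f : H) (x : X) :
    ‖w x * extendZero (f : A → ℝ) x‖ ≤ W * κ * ‖f‖ := by
  by_cases hx : x ∈ A
  · rw [norm_mul, extendZero, dif_pos hx, mul_assoc]
    gcongr
    exacts [hA.norm_weight_le x, hA.boundedFeature.norm_apply_le f _]
  · rw [extendZero_of_notMem hx, mul_zero, norm_zero]
    positivity

theorem memLp_mul_extendZero (hA : IsWeightedRegion A H w κ W) (μ : Measure X) (f : H) :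
    MemLp (fun x => w x * extendZero (f : A → ℝ) x) ∞ μ :=
  memLp_top_of_bound (hA.measurable_weight.mul (measurable_extendZero hA.measurableSet
    (hA.boundedFeature.measurable_coe f))).aestronglyMeasurable _
    (Eventually.of_forall (hA.norm_mul_extendZero_le f))

/-- The continuous linear map `f ↦ w f` from the reproducing kernel Hilbert space on a weighted
region to `L^∞(μ)`. -/
noncomputable def embedding (hA : IsWeightedRegion A H w κ W) (μ : Measure X) :
    H →L[ℝ] Lp ℝ ∞ μ :=
  LinearMap.mkContinuous
    { toFun := fun f => (hA.memLp_mul_extendZero μ f).toLp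
      map_add' := fun f g => by
        rw [← MemLp.toLp_add]
        refine MemLp.toLp_congr _ _ (Eventually.of_forall fun x => ?_)
        simp only [extendZero_coe_add, mul_add, Pi.add_apply]
      map_smul' := fun c f => by
        rw [RingHom.id_apply, ← MemLp.toLp_const_smul]
        refine MemLp.toLp_congr _ _ (Eventually.of_forall fun x => ?_)
        simp only [extendZero_coe_smul, mul_left_comm, Pi.smul_apply, smul_eq_mul] }
    (W * κ) fun f => by
      rw [LinearMap.coe_mk, AddHom.coe_mk, Lp.norm_toLp, eLpNorm_exponent_top]
      exact ENNReal.toReal_le_of_le_ofReal (by positivity) (eLpNormEssSup_le_of_ae_bound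
        (Eventually.of_forall (hA.norm_mul_extendZero_le f)))

variable {μ : Measure X}

theorem coeFn_embedding (hA : IsWeightedRegion A H w κ W) (f : H) :
    hA.embedding μ f =ᵐ[μ] fun x => w x * extendZero (f : A → ℝ) x :=
  (hA.memLp_mul_extendZero μ f).coeFn_toLp

theorem norm_embedding_apply_le (hA : IsWeightedRegion A H w κ W) (f : H) :
    ‖hA.embedding μ f‖ ≤ W * κ * ‖f‖ :=
  (hA.embedding μ).le_of_opNorm_le (LinearMap.mkContinuous_norm_le _ (by positivity) _) f

theorem embedding_apply_eq_zero (hA : IsWeightedRegion A H w κ W) (h0 : μ A = 0) (f : H) :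
    hA.embedding μ f = 0 := by
  refine Lp.ext ?_
  filter_upwards [hA.coeFn_embedding f, Lp.coeFn_zero ℝ ∞ μ,
    measure_eq_zero_iff_ae_notMem.1 h0] with x hf hzero hx
  rw [hf, hzero, extendZero_of_notMem hx, mul_zero, Pi.zero_apply]

theorem measure_prod_univ_ne_zero {Y : Type*} [MeasurableSpace Y] {P : Measure (X × Y)}
    (hA : IsWeightedRegion A H w κ W) (h0 : P.fst A ≠ 0) : P (A ×ˢ univ) ≠ 0 := by
  rwa [Measure.fst_apply hA.measurableSet, ← prod_univ] at h0

end IsWeightedRegion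

end WeightedRegion

section Compose

theorem memLp_of_coeFn_ae_eq {X : Type*} [MeasurableSpace X] {μ : Measure X} {f : X → ℝ}
    {G : Lp ℝ ∞ μ} (h : G =ᵐ[μ] f) : MemLp f ∞ μ :=
  (memLp_congr_ae h).1 (Lp.memLp G)

theorem linftyClass_eq_of_coeFn_ae_eq {X : Type*} [MeasurableSpace X] {μ : Measure X}
    {f : X → ℝ} {G : Lp ℝ ∞ μ} (h : G =ᵐ[μ] f) : linftyClass μ f = G := by
  have hf := memLp_of_coeFn_ae_eq h
  rw [linftyClass, dif_pos hf]
  exact Lp.ext (hf.coeFn_toLp.trans h.symm)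

variable {X Y : Type*} [MeasurableSpace X] [MeasurableSpace Y] {B : ℕ} {R : Fin B → Set X}
  {H : Fin B → Type*} [∀ b, NormedAddCommGroup (H b)] [∀ b, InnerProductSpace ℝ (H b)]
  [∀ b, CompleteSpace (H b)] [∀ b, RKHS ℝ (H b) (R b) ℝ] {L : Y → ℝ → ℝ} {lam : Fin B → ℝ}
  {w : Fin B → X → ℝ} {κ W : Fin B → ℝ≥0} {μ : Measure X}

theorem coeFn_sum_embedding (hR : ∀ b, IsWeightedRegion (R b) (H b) (w b) (κ b) (W b))
    (f : ∀ b, H b) :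
    ⇑(∑ b, (hR b).embedding μ (f b)) =ᵐ[μ] fun x => ∑ b, w b x * extendZero (⇑(f b)) x := by
  filter_upwards [ae_all_iff.2 fun b => (hR b).coeFn_embedding (f b),
    Lp.coeFn_finsetSum Finset.univ fun b => (hR b).embedding μ (f b)] with x hf hsum
  rw [hsum, Finset.sum_apply]
  exact Finset.sum_congr rfl fun b _ => hf b

theorem norm_sum_embedding_le (hR : ∀ b, IsWeightedRegion (R b) (H b) (w b) (κ b) (W b))
    {f : ∀ b, H b} {c : Fin B → ℝ} (hf : ∀ b, ‖f b‖ ≤ c b) :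
    ‖∑ b, (hR b).embedding μ (f b)‖ ≤ ∑ b, W b * κ b * c b :=
  norm_sum_le_of_le _ fun b _ => ((hR b).norm_embedding_apply_le (f b)).trans (by
    gcongr
    exact hf b)

theorem coeFn_sum_embedding_svm (hR : ∀ b, IsWeightedRegion (R b) (H b) (w b) (κ b) (W b))
    (v : ∀ b, R b → ℝ) {Q : ∀ b, Measure (R b × Y)}
    (hQ : ∀ b, μ (R b) ≠ 0 → IsProbabilityMeasure (Q b)) :
    ⇑(∑ b, (hR b).embedding μ (svm (H b) L (lam b) (Q b))) =ᵐ[μ] compose H L lam w v Q := by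
  have hnull : ∀ b, ∀ᵐ x ∂μ, μ (R b) = 0 → x ∉ R b := fun b => by
    by_cases h0 : μ (R b) = 0
    · exact (measure_eq_zero_iff_ae_notMem.1 h0).mono fun _ hx _ => hx
    · exact Eventually.of_forall fun _ h => absurd h h0
  filter_upwards [coeFn_sum_embedding hR _, ae_all_iff.2 hnull] with x hsum hx
  rw [hsum]
  refine Finset.sum_congr rfl fun b _ => ?_
  by_cases h0 : μ (R b) = 0
  · rw [extendZero_of_notMem (hx b h0), extendZero_of_notMem (hx b h0)]
  · rw [if_pos (hQ b h0)]

theorem memLp_compose (hR : ∀ b, IsWeightedRegion (R b) (H b) (w b) (κ b) (W b))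
    (v : ∀ b, R b → ℝ) {Q : ∀ b, Measure (R b × Y)}
    (hQ : ∀ b, μ (R b) ≠ 0 → IsProbabilityMeasure (Q b)) :
    MemLp (compose H L lam w v Q) ∞ μ :=
  memLp_of_coeFn_ae_eq (coeFn_sum_embedding_svm hR v hQ)

theorem tendsto_linftyClass_compose
    (hR : ∀ b, IsWeightedRegion (R b) (H b) (w b) (κ b) (W b)) {v : ℝ → ∀ b, R b → ℝ}
    {v₀ : ∀ b, R b → ℝ} {Q : ℝ → ∀ b, Measure (R b × Y)} {Q₀ : ∀ b, Measure (R b × Y)}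
    (hQ : ∀ ε ∈ Ico (0 : ℝ) 1, ∀ b, μ (R b) ≠ 0 → IsProbabilityMeasure (Q ε b))
    (hQ₀ : ∀ b, μ (R b) ≠ 0 → IsProbabilityMeasure (Q₀ b)) {g : ∀ b, H b}
    (hg : ∀ b, μ (R b) ≠ 0 → Tendsto (fun ε : ℝ => ε⁻¹ •
      (svm (H b) L (lam b) (Q ε b) - svm (H b) L (lam b) (Q₀ b))) (𝓝[>] 0) (𝓝 (g b))) :
    Tendsto (fun ε : ℝ => ε⁻¹ • (linftyClass μ (compose H L lam w (v ε) (Q ε)) -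
      linftyClass μ (compose H L lam w v₀ Q₀))) (𝓝[>] 0)
      (𝓝 (∑ b, (hR b).embedding μ (g b))) := by
  have hterm : ∀ b, Tendsto (fun ε : ℝ => (hR b).embedding μ (ε⁻¹ •
      (svm (H b) L (lam b) (Q ε b) - svm (H b) L (lam b) (Q₀ b)))) (𝓝[>] 0)
      (𝓝 ((hR b).embedding μ (g b))) := fun b => by
    by_cases h0 : μ (R b) = 0
    · simp only [(hR b).embedding_apply_eq_zero h0, tendsto_const_nhds]
    · exact (((hR b).embedding μ).continuous.tendsto _).comp (hg b h0)
  refine (tendsto_finsetSum Finset.univ fun b _ => hterm b).congr' ?_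
  filter_upwards [Ioo_mem_nhdsGT one_pos] with ε hε
  rw [linftyClass_eq_of_coeFn_ae_eq
      (coeFn_sum_embedding_svm hR (v ε) (hQ ε (Ioo_subset_Ico_self hε))),
    linftyClass_eq_of_coeFn_ae_eq (coeFn_sum_embedding_svm hR v₀ hQ₀), ← Finset.sum_sub_distrib,
    Finset.smul_sum]
  simp only [map_smul, map_sub]

end Compose

section Predictor

variable {X Y : Type*} [MeasurableSpace X] [MeasurableSpace Y]

variable {B : ℕ} {R : Fin B → Set X} {H : Fin B → Type*} [∀ b, NormedAddCommGroup (H b)]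
  [∀ b, InnerProductSpace ℝ (H b)] [∀ b, CompleteSpace (H b)] [∀ b, RKHS ℝ (H b) (R b) ℝ]
  {L : Y → ℝ → ℝ} {lam : Fin B → ℝ} {w : Fin B → X → ℝ} {κ W : Fin B → ℝ≥0}
  {P : Measure (X × Y)} [IsFiniteMeasure P]

theorem memLp_regionalCompPredictor (hR : ∀ b, IsWeightedRegion (R b) (H b) (w b) (κ b) (W b))
    (u : Measure (X × Y) → ∀ b, R b → ℝ) (z : X × Y) {ε : ℝ} (hε : ε ∈ Ico (0 : ℝ) 1) :
    MemLp (regionalCompPredictor H L lam w u P z ε) ∞ P.fst :=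
  memLp_compose hR _ fun b h0 =>
    isProbabilityMeasure_regionalContaminate (hR b).measurableSet
      ((hR b).measure_prod_univ_ne_zero h0) z (Ico_subset_Icc_self hε)

theorem memLp_compPredictor_contaminate
    (hR : ∀ b, IsWeightedRegion (R b) (H b) (w b) (κ b) (W b))
    (u : Measure (X × Y) → ∀ b, R b → ℝ) (z : X × Y) {ε : ℝ} (hε : ε < 1) :
    MemLp (compPredictor H L lam w u (contaminate P z ε)) ∞ P.fst :=
  memLp_compose hR _ fun b h0 =>
    isProbabilityMeasure_regional_contaminate (hR b).measurableSet
      ((hR b).measure_prod_univ_ne_zero h0) z hε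

theorem tendsto_regionalCompPredictor
    (hR : ∀ b, IsWeightedRegion (R b) (H b) (w b) (κ b) (W b))
    (u : Measure (X × Y) → ∀ b, R b → ℝ) {z : X × Y} {g : ∀ b, H b}
    (hg : ∀ b, IsLocalInfluenceFunction L (lam b) P z (g b)) :
    Tendsto (fun ε : ℝ => ε⁻¹ •
      (linftyClass P.fst (regionalCompPredictor H L lam w u P z ε) -
        linftyClass P.fst (compPredictor H L lam w u P))) (𝓝[>] 0)
      (𝓝 (∑ b, (hR b).embedding P.fst (g b))) :=
  tendsto_linftyClass_compose hR
    (fun _ hε b h0 => isProbabilityMeasure_regionalContaminate (hR b).measurableSet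
      ((hR b).measure_prod_univ_ne_zero h0) z (Ico_subset_Icc_self hε))
    (fun b h0 => isProbabilityMeasure_regional (hR b).measurableSet
      ((hR b).measure_prod_univ_ne_zero h0))
    fun b h0 => (hg b).tendsto_regionalContaminate ((hR b).measure_prod_univ_ne_zero h0)

theorem hasInfluenceFunction_compPredictor
    (hR : ∀ b, IsWeightedRegion (R b) (H b) (w b) (κ b) (W b))
    (u : Measure (X × Y) → ∀ b, R b → ℝ) {z : X × Y} {g : ∀ b, H b}
    (hg : ∀ b, IsLocalInfluenceFunction L (lam b) P z (g b)) :
    HasInfluenceFunction (fun Q => linftyClass P.fst (compPredictor H L lam w u Q)) P z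
      (∑ b, (hR b).embedding P.fst ((P.real (R b ×ˢ univ))⁻¹ • g b)) :=
  tendsto_linftyClass_compose hR
    (fun _ hε b h0 => isProbabilityMeasure_regional_contaminate (hR b).measurableSet
      ((hR b).measure_prod_univ_ne_zero h0) z hε.2)
    (fun b h0 => isProbabilityMeasure_regional (hR b).measurableSet
      ((hR b).measure_prod_univ_ne_zero h0))
    fun b h0 => (hg b).tendsto_regional_contaminate (hR b).measurableSet
      ((hR b).measure_prod_univ_ne_zero h0)

end Predictor

end LocalSVM

theorem theorem3p3_general {X Y : Type*} [MeasurableSpace X] [MeasurableSpace Y]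
    (B : ℕ) (R : Fin B → Set X) (hR : ∀ b, MeasurableSet (R b))
    (w : Fin B → X → ℝ) (hwmeas : ∀ b, Measurable (w b))
    (hwbdd : ∀ b, ∃ W : NNReal, ∀ x, ‖w b x‖ ≤ W)
    (H : Fin B → Type*) [∀ b, NormedAddCommGroup (H b)] [∀ b, InnerProductSpace ℝ (H b)]
    [∀ b, CompleteSpace (H b)] [∀ b, RKHS ℝ (H b) (R b) ℝ]
    (hΦmeas : ∀ b, StronglyMeasurable (LocalSVM.featureMap (H b) : R b → H b))
    (hkbdd : ∀ b, BddAbove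
      (Set.range fun x : R b => Real.sqrt (LocalSVM.scalarKernel (H b) x x)))
    (L : Y → ℝ → ℝ) (hLmeas : Measurable (Function.uncurry L))
    (hLconv : ∀ y, ConvexOn ℝ Set.univ (L y))
    (hLdiff : ∀ y, Differentiable ℝ (L y)) (hLdiff' : ∀ y, Differentiable ℝ (deriv (L y)))
    (hL1fin : ⨆ y, ⨆ t, ‖deriv (L y) t‖ₑ < ∞)
    (hL2fin : ⨆ y, ⨆ t, ‖deriv (deriv (L y)) t‖ₑ < ∞)
    (lam : Fin B → ℝ) (hlam : ∀ b, 0 < lam b) (u : Measure (X × Y) → ∀ b, R b → ℝ)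
    (P : Measure (X × Y)) [IsFiniteMeasure P] :
    (∀ b, ∀ Q : Measure (R b × Y), IsProbabilityMeasure Q →
      ∃! f : H b, LocalSVM.IsSVM L Q (lam b) f) ∧
    ∃ C : ℝ, ∀ z : X × Y, ∃ g : ∀ b, H b,
      (∀ b, LocalSVM.IsLocalInfluenceFunction L (lam b) P z (g b)) ∧
      (∀ ε ∈ Set.Ico (0 : ℝ) 1,
        MemLp (LocalSVM.regionalCompPredictor H L lam w u P z ε) ∞ P.fst) ∧
      (∃ G : Lp ℝ ∞ P.fst,
        Tendsto (fun ε : ℝ => ε⁻¹ •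
            (LocalSVM.linftyClass P.fst (LocalSVM.regionalCompPredictor H L lam w u P z ε) -
              LocalSVM.linftyClass P.fst (LocalSVM.compPredictor H L lam w u P)))
          (𝓝[>] 0) (𝓝 G) ∧
        (G =ᵐ[P.fst] fun x => ∑ b, w b x * LocalSVM.extendZero (⇑(g b)) x) ∧
        ‖G‖ ≤ C) ∧
      (∀ ε ∈ Set.Ico (0 : ℝ) 1,
        MemLp (LocalSVM.compPredictor H L lam w u (LocalSVM.contaminate P z ε)) ∞ P.fst) ∧
      (∃ G : Lp ℝ ∞ P.fst,
        LocalSVM.HasInfluenceFunction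
          (fun Q => LocalSVM.linftyClass P.fst (LocalSVM.compPredictor H L lam w u Q)) P z G ∧
        (G =ᵐ[P.fst] fun x => ∑ b,
          (P.real (R b ×ˢ Set.univ))⁻¹ * (w b x * LocalSVM.extendZero (⇑(g b)) x)) ∧
        ‖G‖ ≤ C) := by
  obtain ⟨M₁, M₂, hL⟩ :=
    LocalSVM.exists_smoothConvexLoss hLmeas hLconv hLdiff hLdiff' hL1fin hL2fin
  choose κ hΦ using fun b => LocalSVM.exists_boundedFeature (hΦmeas b) (hkbdd b)
  choose W hW using hwbdd
  have hreg : ∀ b, LocalSVM.IsWeightedRegion (R b) (H b) (w b) (κ b) (W b) := fun b =>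
    ⟨hR b, hΦ b, hwmeas b, hW b⟩
  refine ⟨fun b Q _ => hL.existsUnique_isSVM (hΦ b) (hlam b), max
    (∑ b, W b * κ b * (M₁ * κ b / lam b))
    (∑ b, W b * κ b * ((P.real (R b ×ˢ univ))⁻¹ * (M₁ * κ b / lam b))), fun z => ?_⟩
  have hg := fun b =>
    LocalSVM.isLocalInfluenceFunction_localInfluence (P := P) hL (hR b) (hΦ b) (hlam b) z
  have hgle := fun b =>
    LocalSVM.norm_localInfluence_le (P := P) hL (hR b) (hΦ b) (hlam b) z
  refine ⟨_, hg, fun _ hε => LocalSVM.memLp_regionalCompPredictor hreg u z hε,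
    ⟨_, LocalSVM.tendsto_regionalCompPredictor hreg u hg, LocalSVM.coeFn_sum_embedding hreg _,
      (LocalSVM.norm_sum_embedding_le hreg hgle).trans (le_max_left _ _)⟩,
    fun _ hε => LocalSVM.memLp_compPredictor_contaminate hreg u z hε.2,
    ⟨_, LocalSVM.hasInfluenceFunction_compPredictor hreg u hg, ?_,
      (LocalSVM.norm_sum_embedding_le hreg fun b => ?_).trans (le_max_right _ _)⟩⟩
  · simpa only [LocalSVM.extendZero_coe_smul, mul_left_comm] using
      LocalSVM.coeFn_sum_embedding (μ := P.fst) hreg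
        fun b => (P.real (R b ×ˢ univ))⁻¹ • LocalSVM.localInfluence (H b) L (lam b) P z
  · rw [norm_smul, Real.norm_of_nonneg (inv_nonneg.2 measureReal_nonneg)]
    gcongr
    exact hgle b

theorem theorem3p3
    {X : Type*} [MetricSpace X] [MeasurableSpace X] [BorelSpace X]
    -- the output space
    (Y : Set ℝ) (hY : IsClosed Y)
    -- the regions: complete separable metric spaces
    (B : ℕ) (R : Fin B → Set X)
    (hRcomplete : ∀ b, IsComplete (R b))
    (hRsep : ∀ b, TopologicalSpace.IsSeparable (R b))
    -- the weights
    (w : Fin B → X → ℝ) (hwmeas : ∀ b, Measurable (w b))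
    (hw01 : ∀ b x, w b x ∈ Set.Icc (0 : ℝ) 1)
    (hW1 : ∀ x, ∑ b, w b x = 1)
    (hW2 : ∀ b, ∀ x ∉ R b, w b x = 0)
    -- the RKHSs, with bounded continuous kernels
    (H : Fin B → Type*) [∀ b, NormedAddCommGroup (H b)] [∀ b, InnerProductSpace ℝ (H b)]
    [∀ b, CompleteSpace (H b)] [∀ b, RKHS ℝ (H b) (R b) ℝ]
    (hkbdd : ∀ b, BddAbove
      (Set.range fun x : R b => Real.sqrt (LocalSVM.scalarKernel (H b) x x)))
    (hkcont : ∀ b, Continuous fun p : R b × R b => LocalSVM.scalarKernel (H b) p.1 p.2)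
    -- the loss
    (L : Y → ℝ → ℝ) (hLmeas : Measurable (Function.uncurry L)) (hLnonneg : ∀ y t, 0 ≤ L y t)
    (hLconv : ∀ y, ConvexOn ℝ Set.univ (L y))
    (hLlip : ∃ c : NNReal, ∀ y, LipschitzWith c (L y))
    (hLdiff : ∀ y, ContDiff ℝ 2 (L y))
    (hL1pos : 0 < ⨆ y, ⨆ t, ‖deriv (L y) t‖ₑ)
    (hL1fin : ⨆ y, ⨆ t, ‖deriv (L y) t‖ₑ < ∞)
    (hL2fin : ⨆ y, ⨆ t, ‖deriv (deriv (L y)) t‖ₑ < ∞)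
    -- the regularization parameters
    (lam : Fin B → ℝ) (hlam : ∀ b, 0 < lam b)
    -- the arbitrary measurable predictors used on null regions
    (u : Measure (X × Y) → ∀ b, R b → ℝ) (hu : ∀ Q b, Measurable (u Q b))
    -- the distribution
    (P : Measure (X × Y)) [IsProbabilityMeasure P] :
    -- the local SVMs are well defined
    (∀ b, ∀ Q : Measure (R b × Y), IsProbabilityMeasure Q →
      ∃! f : H b, LocalSVM.IsSVM L Q (lam b) f) ∧
    -- there is a bound that does not depend on `z`
    ∃ C : ℝ, ∀ z : X × Y,
      -- the local influence functions exist
      ∃ g : ∀ b, H b,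
        (∀ b, LocalSVM.IsLocalInfluenceFunction L (lam b) P z (g b)) ∧
        -- the composed influence function for the regionwise mixtures
        (∀ ε ∈ Set.Ico (0 : ℝ) 1,
          MemLp (LocalSVM.regionalCompPredictor H L lam w u P z ε) ∞ P.fst) ∧
        (∃ G : Lp ℝ ∞ P.fst,
          Tendsto (fun ε : ℝ => ε⁻¹ •
              (LocalSVM.linftyClass P.fst (LocalSVM.regionalCompPredictor H L lam w u P z ε) -
                LocalSVM.linftyClass P.fst (LocalSVM.compPredictor H L lam w u P)))
            (𝓝[>] 0) (𝓝 G) ∧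
          (G =ᵐ[P.fst] fun x => ∑ b, w b x * LocalSVM.extendZero (⇑(g b)) x) ∧
          ‖G‖ ≤ C) ∧
        -- the composed influence function for the mixture `(1 - ε) P + ε δ_z` itself
        (∀ ε ∈ Set.Ico (0 : ℝ) 1,
          MemLp (LocalSVM.compPredictor H L lam w u (LocalSVM.contaminate P z ε)) ∞ P.fst) ∧
        (∃ G : Lp ℝ ∞ P.fst,
          LocalSVM.HasInfluenceFunction
            (fun Q => LocalSVM.linftyClass P.fst (LocalSVM.compPredictor H L lam w u Q))
            P z G ∧
          (G =ᵐ[P.fst] fun x => ∑ b,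
            (P.real (R b ×ˢ Set.univ))⁻¹ * (w b x * LocalSVM.extendZero (⇑(g b)) x)) ∧
          ‖G‖ ≤ C) := by
  have hderiv : ∀ y, Differentiable ℝ (deriv (L y)) := fun y =>
    ((contDiff_succ_iff_deriv (n := 1)).1 (hLdiff y)).2.2.differentiable one_ne_zero
  exact theorem3p3_general B R (fun b => (hRcomplete b).isClosed.measurableSet) w hwmeas
    (fun b => ⟨1, fun x => abs_le.2 ⟨by linarith [(hw01 b x).1], (hw01 b x).2⟩⟩) H
    (fun b => LocalSVM.stronglyMeasurable_featureMap_of_isSeparable (hRsep b) (hkcont b)) hkbdd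
    L hLmeas hLconv (fun y => (hLdiff y).differentiable two_ne_zero) hderiv hL1fin hL2fin lam
    hlam u P
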